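/- Let $G$ be a finite group acting by homeomorphisms on a Hausdorff space $T$ that is aspherical, i.e. path connected with $\pi_n(T)=0$ for all $n\ge 2$. Let $\mathbf{E}G$ be a contractible Hausdorff space with a free action of $G$ by homeomorphisms, and let $G$ act diagonally (hence freely) on $T\times \mathbf{E}G$. For $x\in T$ and $e\in \mathbf{E}G$, the covering $T\times\mathbf{E}G\to(T\times\mathbf{E}G)/G$ gives the subordinate extension $$1\to\pi_1(T,x)\to\pi_1\bigl((T\times\mathbf{E}G)/G,[(x,e)]\bigr)\xrightarrow{\ \partial\ }G\to 1,$$ in which the first map is induced by $y\mapsto[(y,e)]$ and $\partial$ is the boundary homomorphism of the covering. Suppose that the action of $G$ on $T$ has a fixed point. Then: 1. For all $x\in T$ and $e\in \mathbf{E}G$ the subordinate extension splits; that is, for some homomorphism $\varphi:G\to\operatorname{Aut}\pi_1(T,x)$ it is congruent (isomorphic by an isomorphism that is the identity on $\pi_1(T,x)$ and on $G$) to the extension $1\to\pi_1(T,x)\to\pi_1(T,x)\rtimes_\varphi G\to G\to1$. 2. For every fixed point $x_0\in T$ and every $e\in \mathbf{E}G$, the map $S:\mathbf{E}G/G\to(T\times\mathbf{E}G)/G$,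 $[e']\mapsto[(x_0,e')]$, is a continuous section of the projection $P:(T\times\mathbf{E}G)/G\to\mathbf{E}G/G$, $[(y,e')]\mapsto[e']$; the boundary homomorphism $\partial_{\mathbf{E}}:\pi_1(\mathbf{E}G/G,[e])\to G$ of the covering $\mathbf{E}G\to\mathbf{E}G/G$ is bijective; and the homomorphism $S_\#\circ\partial_{\mathbf{E}}^{-1}:G\to\pi_1\bigl((T\times\mathbf{E}G)/G,[(x_0,e)]\bigr)$ is a splitting of the subordinate extension at $(x_0,e)$. -/

import Mathlib

open scoped Topology

/-- A `K(π, 1)`-space: path connected, with trivial homotopy groups in all degrees `n ≥ 2`. -/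
class IsAspherical (T : Type*) [TopologicalSpace T] : Prop extends PathConnectedSpace T where
  subsingleton_pi (n : ℕ) (hn : 2 ≤ n) (x : T) : Subsingleton (π_ n T x)

theorem fundamentalGroup_mapOfEq_rfl {X Y : Type*} [TopologicalSpace X] [TopologicalSpace Y]
    (f : C(X, Y)) (x : X) (p : FundamentalGroup X x) :
    FundamentalGroup.mapOfEq f rfl p = FundamentalGroup.map f x p := by
  rw [FundamentalGroup.mapOfEq_apply, Path.Homotopic.Quotient.cast_rfl_rfl]
  rfl

section FreeQuotient

variable (G : Type*) [Group G] (X : Type*) [TopologicalSpace X] [MulAction G X]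

/-- The orbit space `X / G` with the quotient topology. -/
abbrev OrbitSpace : Type _ := MulAction.orbitRel.Quotient G X

variable {X}

/-- The orbit of `x`, as a point of `X / G`. -/
abbrev orbitPt (x : X) : OrbitSpace G X := Quotient.mk (MulAction.orbitRel G X) x

theorem isQuotientCoveringMap_orbitPt [Finite G] [T2Space X] [ContinuousConstSMul G X]
    [IsCancelSMul G X] : IsQuotientCoveringMap (orbitPt G (X := X)) G where
  __ := (isQuotientMap_quotient_mk' : Topology.IsQuotientMap (Quotient.mk (MulAction.orbitRel G X)))
  continuous_const_smul := continuous_const_smul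
  apply_eq_iff_mem_orbit := Quotient.eq''
  disjoint x := by
    have key : ∀ g : G, ∃ U ∈ 𝓝 x, g ≠ 1 → Disjoint ((g • ·) '' U) U := by
      intro g
      by_cases hg : g = 1
      · exact ⟨Set.univ, Filter.univ_mem, fun h => absurd hg h⟩
      · have hne : g • x ≠ x := fun h => hg (IsCancelSMul.eq_one_of_smul h)
        obtain ⟨V, W, hV, hW, hgx, hx, hVW⟩ := t2_separation hne
        refine ⟨(g • ·) ⁻¹' V ∩ W, Filter.inter_mem ?_ (hW.mem_nhds hx), fun _ => ?_⟩
        · exact (hV.preimage (continuous_const_smul g)).mem_nhds hgx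
        · refine hVW.mono ?_ Set.inter_subset_right
          rintro _ ⟨y, hy, rfl⟩
          exact hy.1
    choose U hU hdisj using key
    refine ⟨⋂ g, U g, (Filter.iInter_mem).2 hU, fun g hg => ?_⟩
    by_contra hne
    obtain ⟨y, ⟨z, hz, hzy⟩, hy⟩ := hg
    exact Set.disjoint_left.1 (hdisj g hne) ⟨z, Set.mem_iInter.1 hz g, hzy⟩
      (Set.mem_iInter.1 hy g)

variable [Finite G] [T2Space X] [ContinuousConstSMul G X] [IsCancelSMul G X]

/-- The boundary homomorphism `π₁(X / G, [x]) → G` of the covering `X → X / G` given by a free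
action.  The class of a loop whose lift starting at `x` ends at `g • x` is sent to `g⁻¹`: the
product of `FundamentalGroup` is `p * q = q.trans p`, so that the inverse is needed for a
homomorphism (see `boundaryHom_apply_eq_iff`). -/
noncomputable def boundaryHom (x : X) :
    FundamentalGroup (OrbitSpace G X) (orbitPt G x) →* G :=
  (MulEquiv.inv' G).symm.toMonoidHom.comp
    ((isQuotientCoveringMap_orbitPt G).fundamentalGroupToMulOpposite ⟨x, rfl⟩)

theorem boundaryHom_apply_eq_iff (x : X)
    (γ : FundamentalGroup (OrbitSpace G X) (orbitPt G x)) (g : G) :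
    boundaryHom G x γ = g ↔
      ((isQuotientCoveringMap_orbitPt G).isCoveringMap.monodromy γ ⟨x, rfl⟩ : X) = g⁻¹ • x := by
  have h := (isQuotientCoveringMap_orbitPt G).fundamentalGroupToMulOpposite_apply_eq_Iff
    (e := ⟨x, rfl⟩) (γ := γ) (g := MulOpposite.op g⁻¹)
  rw [MulOpposite.unop_op, eq_comm (a := g⁻¹ • _)] at h
  rw [← h, boundaryHom, ← MulOpposite.unop_injective.eq_iff, MulOpposite.unop_op,
    ← inv_inj (b := g⁻¹), inv_inv]
  rfl

theorem boundaryHom_surjective [PathConnectedSpace X] (x : X) :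
    Function.Surjective (boundaryHom G x) :=
  (MulEquiv.inv' G).symm.surjective.comp
    ((isQuotientCoveringMap_orbitPt G).fundamentalGroupToMulOpposite_surjective _)

theorem ker_boundaryHom (x : X) :
    (boundaryHom G x).ker = (FundamentalGroup.map
      ⟨orbitPt G, (isQuotientCoveringMap_orbitPt G).continuous⟩ x).range := by
  have h1 := (isQuotientCoveringMap_orbitPt G).ker_fundamentalGroupToMulOpposite
    (x := orbitPt G x) (⟨x, rfl⟩ : orbitPt G ⁻¹' {orbitPt G x})
  have h2 := (isQuotientCoveringMap_orbitPt G).ker_monodromyPerm (x := orbitPt G x)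
    (⟨x, rfl⟩ : orbitPt G ⁻¹' {orbitPt G x})
  ext γ
  have h3 : γ ∈ (boundaryHom G x).ker ↔
      γ ∈ ((isQuotientCoveringMap_orbitPt G).fundamentalGroupToMulOpposite
        (x := orbitPt G x) ⟨x, rfl⟩).ker := by
    simp only [MonoidHom.mem_ker, boundaryHom, MonoidHom.comp_apply]
    exact (MulEquiv.inv' G).symm.map_eq_one_iff
  rw [h3, h1, h2]
  constructor
  · rintro ⟨p, rfl⟩
    exact ⟨p, (fundamentalGroup_mapOfEq_rfl _ x p).symm⟩
  · rintro ⟨p, rfl⟩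
    exact ⟨p, fundamentalGroup_mapOfEq_rfl _ x p⟩

end FreeQuotient

section Borel

variable (G : Type*) [Group G] {T E : Type*} [TopologicalSpace T] [TopologicalSpace E]
  [MulAction G T] [MulAction G E]

instance isCancelSMul_prod_of_right [IsCancelSMul G E] : IsCancelSMul G (T × E) where
  right_cancel' g h x hx := IsCancelSMul.right_cancel g h x.2 (congrArg Prod.snd hx)

variable (T E) in
/-- The Borel construction `(T × E) / G` for the diagonal action `g • (x, e) = (g • x, g • e)`. -/
abbrev BorelConstruction : Type _ := OrbitSpace G (T × E)

/-- The map `T → (T × E) / G`, `x ↦ [(x, e)]`: the inclusion of `T` in `T × E` at height `e`,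
followed by the covering `T × E → (T × E) / G`. -/
def borelInclusion (e : E) : C(T, BorelConstruction G T E) where
  toFun x := orbitPt G (x, e)
  continuous_toFun := continuous_quotient_mk'.comp (by fun_prop)

variable (T E) in
/-- The Cartan-Borel fibration `(T × E) / G → E / G`, `[(x, e)] ↦ [e]`. -/
def borelProjection : C(BorelConstruction G T E, OrbitSpace G E) where
  toFun := Quotient.map Prod.snd (by rintro _ b ⟨g, rfl⟩; exact ⟨g, rfl⟩)
  continuous_toFun := continuous_snd.quotient_map' _

variable (E) in
/-- The map `E / G → (T × E) / G`, `[e] ↦ [(x₀, e)]`, given by a point `x₀` fixed by `G`. -/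
def borelSection (x₀ : T) (hx₀ : x₀ ∈ MulAction.fixedPoints G T) :
    C(OrbitSpace G E, BorelConstruction G T E) where
  toFun := Quotient.map (fun e => (x₀, e)) (by
    rintro _ b ⟨g, rfl⟩
    exact ⟨g, Prod.ext (hx₀ g) rfl⟩)
  continuous_toFun := Continuous.quotient_map' (by fun_prop) _

theorem borelSection_orbitPt (x₀ : T) (hx₀ : x₀ ∈ MulAction.fixedPoints G T) (e : E) :
    borelSection G E x₀ hx₀ (orbitPt G e) = orbitPt G (x₀, e) := rfl

variable [Finite G] [T2Space T] [T2Space E] [ContinuousConstSMul G T] [ContinuousConstSMul G E]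
  [PathConnectedSpace T] [ContractibleSpace E] [IsCancelSMul G E]

/-- The extension `1 → π₁(T, x) → π₁((T × E) / G, [(x, e)]) → G → 1` subordinate to the action of
`G` on `T`: the exact sequence of the covering `T × E → (T × E) / G`, where `E` is contractible
with a free action and `π₁(T, x)` is identified with `π₁(T × E, (x, e))` in the natural way. -/
noncomputable def subordinateExtension (x : T) (e : E) :
    GroupExtension (FundamentalGroup T x)
      (FundamentalGroup (BorelConstruction G T E) (orbitPt G (x, e))) G where
  inl := FundamentalGroup.map (borelInclusion G e) x
  rightHom := boundaryHom G (x, e)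
  inl_injective := by
    intro p q h
    obtain ⟨p, rfl⟩ := Path.Homotopic.Quotient.mk_surjective p
    obtain ⟨q, rfl⟩ := Path.Homotopic.Quotient.mk_surjective q
    have h1 := (isQuotientCoveringMap_orbitPt G (X := T × E)).isCoveringMap.injective_path_homotopic_map
      (x, e) (x, e)
    let ι : C(T, T × E) := ⟨fun y => (y, e), by fun_prop⟩
    have h2 := @h1 (Path.Homotopic.Quotient.mk (p.map ι.continuous))
      (Path.Homotopic.Quotient.mk (q.map ι.continuous)) h
    have h3 := congrArg (fun r => Path.Homotopic.Quotient.map r (⟨Prod.fst, continuous_fst⟩ : C(T × E, T))) h2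
    exact h3
  range_inl_eq_ker_rightHom := by
    rw [ker_boundaryHom]
    ext γ
    constructor
    · rintro ⟨p, rfl⟩
      obtain ⟨p, rfl⟩ := Path.Homotopic.Quotient.mk_surjective p
      exact ⟨Path.Homotopic.Quotient.mk (p.map (f := fun y => (y, e)) (by fun_prop)), rfl⟩
    · rintro ⟨p, rfl⟩
      refine ⟨Path.Homotopic.projLeft p, ?_⟩
      have h : p = Path.Homotopic.prod (Path.Homotopic.projLeft p)
          (Path.Homotopic.Quotient.mk (Path.refl e)) := by
        rw [Subsingleton.elim (Path.Homotopic.Quotient.mk (Path.refl e))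
          (Path.Homotopic.projRight p)]
        exact (Path.Homotopic.prod_projLeft_projRight p).symm
      obtain ⟨q, hq⟩ := Path.Homotopic.Quotient.mk_surjective (Path.Homotopic.projLeft p)
      rw [← hq] at h ⊢
      rw [h]
      rfl
  rightHom_surjective := boundaryHom_surjective G (x, e)

end Borel

/-! A fixed point `x₀` makes `e ↦ (x₀, e)` equivariant, so it descends to a section `S` of the Borel
fibration. The boundary homomorphism is natural for equivariant maps (`boundaryHom_mapOfEq`), hence
`∂ ∘ S_# = ∂_E`; since `E` is contractible, `∂_E` is bijective, and `S_# ∘ ∂_E⁻¹` splits the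
extension at `(x₀, e)`. Other base points `x` are reached by a path in `T × E`: changing base point
along its image preserves `∂`, so the splitting is carried along. -/

section FreeQuotient

variable {G : Type*} [Group G] [Finite G] {X Y : Type*} [TopologicalSpace X] [TopologicalSpace Y]
  [T2Space X] [T2Space Y] [MulAction G X] [MulAction G Y] [ContinuousConstSMul G X]
  [ContinuousConstSMul G Y] [IsCancelSMul G X] [IsCancelSMul G Y]

/-- The boundary homomorphism is natural for equivariant maps. -/
theorem boundaryHom_mapOfEq (f : C(X, Y)) (hf : ∀ (g : G) (x : X), f (g • x) = g • f x)
    (F : C(OrbitSpace G X, OrbitSpace G Y)) (hF : ∀ x, F (orbitPt G x) = orbitPt G (f x)) (x : X)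
    (γ : FundamentalGroup (OrbitSpace G X) (orbitPt G x)) :
    boundaryHom G (f x) (FundamentalGroup.mapOfEq F (hF x) γ) = boundaryHom G x γ := by
  rw [boundaryHom_apply_eq_iff, FundamentalGroup.mapOfEq_apply, ← hf]
  have hγ := (boundaryHom_apply_eq_iff G x γ _).1 rfl
  set cov := (isQuotientCoveringMap_orbitPt G (X := X)).isCoveringMap
  set y := cov.monodromy γ ⟨x, rfl⟩
  have hy2 : orbitPt G (f y) = orbitPt G (f x) := by
    rw [← hF, ← hF]
    exact congrArg F y.2
  -- The image under `f` of the lift of `γ` at `x` lifts `F ∘ γ` at `f x`, so monodromy sends `f x`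
  -- to `f y`.
  have key := (isQuotientCoveringMap_orbitPt G (X := Y)).isCoveringMap.monodromy_eq_of_map_eq
    (γ := (Path.Homotopic.Quotient.map γ F).cast (hF x).symm (hF x).symm)
    (ex := ⟨f x, rfl⟩) (ey := ⟨f y, hy2⟩) ((cov.liftPathQuotient γ ⟨x, rfl⟩).map f) (by
      have h : ∀ {a b : X} (q : Path.Homotopic.Quotient a b),
          (q.map f).map ⟨orbitPt G, continuous_quotient_mk'⟩ =
            Path.Homotopic.Quotient.cast (Path.Homotopic.Quotient.map
              (q.map ⟨orbitPt G, continuous_quotient_mk'⟩) F) (hF a).symm (hF b).symm := by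
        rintro a b ⟨q⟩
        exact congrArg Path.Homotopic.Quotient.mk (Path.ext (funext fun t => (hF (q t)).symm))
      rw [h, cov.map_liftPathQuotient]
      refine (congrArg (fun q => Path.Homotopic.Quotient.cast q _ _)
        (Path.Homotopic.Quotient.map_cast (f := F) γ)).trans ?_
      exact (Path.Homotopic.Quotient.cast_cast ..).trans
        (Path.Homotopic.Quotient.cast_cast ..).symm)
  rw [← hγ]
  exact congrArg Subtype.val key

/-- Changing the base point along the image of a path in the covering space does not change the
boundary homomorphism. -/
theorem boundaryHom_fundamentalGroupMulEquivOfPath {x y : X} (p : Path y x)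
    (γ : FundamentalGroup (OrbitSpace G X) (orbitPt G y)) :
    boundaryHom G x (FundamentalGroup.fundamentalGroupMulEquivOfPath
      (p.map (f := orbitPt G) continuous_quotient_mk') γ) = boundaryHom G y γ := by
  rw [boundaryHom_apply_eq_iff]
  have hγ := (boundaryHom_apply_eq_iff G y γ _).1 rfl
  set g := boundaryHom G y γ
  have hc := isQuotientCoveringMap_orbitPt G (X := X)
  have h1 := hc.isCoveringMap.monodromy_map (.mk p)
  have h2 := hc.isCoveringMap.monodromy_map (.mk p.symm)
  have hγ' : hc.isCoveringMap.monodromy γ ⟨y, rfl⟩ = hc.toPermFiber _ g⁻¹ ⟨y, rfl⟩ :=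
    Subtype.ext hγ
  -- The new loop is `p` reversed, then `γ`, then `p`, all projected. Its lift from `x` runs back to
  -- `y`, on to `g⁻¹ • y`, then along the translate of `p` by `g⁻¹`, ending at `g⁻¹ • x`.
  change (hc.isCoveringMap.monodromy (Path.Homotopic.Quotient.trans
    ((Path.Homotopic.Quotient.mk p.symm).map ⟨orbitPt G, hc.continuous⟩)
    (Path.Homotopic.Quotient.trans γ
      ((Path.Homotopic.Quotient.mk p).map ⟨orbitPt G, hc.continuous⟩))) ⟨x, rfl⟩ : X) = _
  rw [IsCoveringMap.monodromy_trans_apply, IsCoveringMap.monodromy_trans_apply, h2, hγ',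
    hc.monodromy_toPermFiber, h1]
  rfl

/-- The kernel is the image of `π₁(X, x)`, which is trivial for contractible `X`. -/
theorem boundaryHom_bijective [ContractibleSpace X] (x : X) :
    Function.Bijective (boundaryHom G x) := by
  refine ⟨?_, boundaryHom_surjective G x⟩
  rw [← MonoidHom.ker_eq_bot_iff, ker_boundaryHom, eq_bot_iff]
  rintro _ ⟨p, rfl⟩
  rw [Subgroup.mem_bot, Subsingleton.elim (α := Path.Homotopic.Quotient x x) p
    (1 : FundamentalGroup X x), map_one]

end FreeQuotient

section Borel

variable {G : Type*} [Group G] [Finite G] {T E : Type*} [TopologicalSpace T] [TopologicalSpace E]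
  [MulAction G T] [MulAction G E] [T2Space T] [T2Space E] [ContinuousConstSMul G T]
  [ContinuousConstSMul G E] [IsCancelSMul G E]

/-- The boundary homomorphism of `T × E → (T × E) / G` restricts along the section given by a
fixed point to the boundary homomorphism of `E → E / G`. -/
theorem boundaryHom_mapOfEq_borelSection (x₀ : T) (hx₀ : x₀ ∈ MulAction.fixedPoints G T) (e : E)
    (γ : FundamentalGroup (OrbitSpace G E) (orbitPt G e)) :
    boundaryHom G (x₀, e) (FundamentalGroup.mapOfEq (borelSection G E x₀ hx₀)
      (borelSection_orbitPt G x₀ hx₀ e) γ) = boundaryHom G e γ :=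
  boundaryHom_mapOfEq (⟨fun e => (x₀, e), by fun_prop⟩ : C(E, T × E))
    -- Equivariance is exactly the condition `g • x₀ = x₀`.
    (fun g _ => Prod.ext (hx₀ g).symm rfl) (borelSection G E x₀ hx₀)
    (borelSection_orbitPt G x₀ hx₀) e γ

variable [PathConnectedSpace T] [ContractibleSpace E]

/-- The splitting `S_# ∘ ∂⁻¹` of the subordinate extension at a fixed point. -/
noncomputable def fixedPointSplitting (x₀ : T) (hx₀ : x₀ ∈ MulAction.fixedPoints G T) (e : E) :
    (subordinateExtension G x₀ e).Splitting where
  __ := (FundamentalGroup.mapOfEq (borelSection G E x₀ hx₀)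
    (borelSection_orbitPt G x₀ hx₀ e)).comp
      (MulEquiv.ofBijective (boundaryHom G e) (boundaryHom_bijective e)).symm.toMonoidHom
  rightInverse_rightHom g := (boundaryHom_mapOfEq_borelSection x₀ hx₀ e _).trans
    ((MulEquiv.ofBijective (boundaryHom G e) (boundaryHom_bijective e)).apply_symm_apply g)

theorem fixedPointSplitting_boundaryHom (x₀ : T) (hx₀ : x₀ ∈ MulAction.fixedPoints G T) (e : E)
    (γ : FundamentalGroup (OrbitSpace G E) (orbitPt G e)) :
    fixedPointSplitting x₀ hx₀ e (boundaryHom G e γ) =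
      FundamentalGroup.mapOfEq (borelSection G E x₀ hx₀) (borelSection_orbitPt G x₀ hx₀ e) γ :=
  congrArg (FundamentalGroup.mapOfEq (borelSection G E x₀ hx₀) (borelSection_orbitPt G x₀ hx₀ e))
    ((MulEquiv.ofBijective (boundaryHom G e) (boundaryHom_bijective e)).symm_apply_apply γ)

/-- Transport of a splitting of the subordinate extension along a path in `T × E`. -/
noncomputable def splittingOfPath {x y : T} {e e' : E} (p : Path (y, e') (x, e))
    (s : (subordinateExtension G y e').Splitting) : (subordinateExtension G x e).Splitting where
  __ := (FundamentalGroup.fundamentalGroupMulEquivOfPath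
    (p.map (f := orbitPt G) continuous_quotient_mk')).toMonoidHom.comp s.toMonoidHom
  rightInverse_rightHom g := (boundaryHom_fundamentalGroupMulEquivOfPath p _).trans
    (s.rightInverse_rightHom g)

end Borel

theorem mainTheorem5 {G T E : Type*} [Group G] [Finite G]
    [TopologicalSpace T] [T2Space T] [IsAspherical T] [MulAction G T] [ContinuousConstSMul G T]
    [TopologicalSpace E] [T2Space E] [ContractibleSpace E] [MulAction G E]
    [ContinuousConstSMul G E] [IsCancelSMul G E]
    (hfix : (MulAction.fixedPoints G T).Nonempty) :
    (∀ (x : T) (e : E),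
      Nonempty (subordinateExtension G x e).Splitting ∧
      ∃ φ : G →* MulAut (FundamentalGroup T x),
        Nonempty ((subordinateExtension G x e).Equiv (SemidirectProduct.toGroupExtension φ))) ∧
    ∀ (x₀ : T) (hx₀ : x₀ ∈ MulAction.fixedPoints G T) (e : E),
      (borelProjection G T E).comp (borelSection G E x₀ hx₀) =
        ContinuousMap.id (OrbitSpace G E) ∧
      Function.Bijective (boundaryHom G e) ∧
      ∃ s : (subordinateExtension G x₀ e).Splitting,
        ∀ γ : FundamentalGroup (OrbitSpace G E) (orbitPt G e),
          s (boundaryHom G e γ) = FundamentalGroup.mapOfEq (borelSection G E x₀ hx₀)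
            (borelSection_orbitPt G x₀ hx₀ e) γ := by
  refine ⟨fun x e => ?_, fun x₀ hx₀ e => ⟨?_, boundaryHom_bijective e,
    fixedPointSplitting x₀ hx₀ e, fixedPointSplitting_boundaryHom x₀ hx₀ e⟩⟩
  · obtain ⟨x₀, hx₀⟩ := hfix
    let s : (subordinateExtension G x e).Splitting :=
      splittingOfPath ((PathConnectedSpace.somePath x₀ x).prod (Path.refl e))
        (fixedPointSplitting x₀ hx₀ e)
    -- The action `φ` is conjugation by `s g` on the normal subgroup `π₁(T, x)`.
    exact ⟨⟨s⟩, s.conjAct, ⟨s.semidirectProductToGroupExtensionEquiv.symm⟩⟩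
  · ext z
    obtain ⟨e', rfl⟩ := Quotient.exists_rep z
    rfl
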